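/- A Minkowski space is a finite-dimensional real normed space. For integers $k\ge 2$, $m\ge 0$, a family $x_1,\dots,x_m$ of (not necessarily distinct) vectors in a Minkowski space $X$ is called $k$-collapsing if $\bigl\|\sum_{i\in I}x_i\bigr\|\le 1$ for every $I\subseteq\{1,\dots,m\}$ with $|I|=k$. Let $\mathcal C_k(X)$ be the largest $m$ such that $X$ contains a $k$-collapsing family of $m$ vectors, all of norm at least $1$, and let $$\overline{\mathcal C}(k,d)=\max\{\mathcal C_k(X) : X \text{ is a } d\text{-dimensional Minkowski space}\}.$$ **Theorem.** Let $k\ge 3$ and $d\ge 2$ be integers. 1. If $\sqrt d<k\le \frac{d+1}{2}$, then $\overline{\mathcal C}(k,d)$ is finite and $$\overline{\mathcal C}(k,d)\le \frac{2d(k-1)^2}{k^2-d}=2d\left(1+\frac{d-2k+1}{k^2-d}\right).$$ 2. If $-2d+\sqrt{6d^2+3d+1}\le k\le 2d-\sqrt{d/2}$, then $\overline{\mathcal C}(k,d)=2d$. 3. If $d\ge 3$ and $k>2d-\sqrt{d/2}$, then $\overline{\mathcal C}(k,d)$ is finite and $$\overline{\mathcal C}(k,d)\le k+\frac{1+\sqrt{2d-3}}{2}.$$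 -/

import Mathlib

/-- A family `x` of `m` (not necessarily distinct) vectors satisfies the `k`-collapsing condition
if every sum of `k` members (with distinct indices) has norm at most `1`. -/
def IsCollapsing {X : Type*} [NormedAddCommGroup X] (k : ℕ) {m : ℕ} (x : Fin m → X) : Prop :=
  ∀ I : Finset (Fin m), I.card = k → ‖∑ i ∈ I, x i‖ ≤ 1

/-- `𝒞_k(X)`: the largest `m` such that some family of `m` vectors of norm at least `1` in `X`
satisfies the `k`-collapsing condition. It is a supremum in `ℕ∞`, hence equal to `⊤` when there are
arbitrarily large such families, and an attained maximum when it is finite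
(the set of sizes contains `0`). -/
noncomputable def collapsingNumber (k : ℕ) (X : Type*) [NormedAddCommGroup X] : ℕ∞ :=
  sSup {n : ℕ∞ | ∃ (m : ℕ) (x : Fin m → X),
    (∀ i, 1 ≤ ‖x i‖) ∧ IsCollapsing k x ∧ n = (m : ℕ∞)}

/-- `C̄(k,d)`: the maximum of `𝒞_k(X)` over all `d`-dimensional real normed spaces `X` (each of which
is isometric to `ℝ^d` with some norm, so that the universe `Type` suffices). It is again a supremum
in `ℕ∞`, which is an attained maximum when it is finite. -/
noncomputable def maxCollapsingNumber (k d : ℕ) : ℕ∞ :=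
  sSup {n : ℕ∞ | ∃ (X : Type) (_ : NormedAddCommGroup X) (_ : NormedSpace ℝ X),
    FiniteDimensional ℝ X ∧ Module.finrank ℝ X = d ∧ n = collapsingNumber k X}

open Finset

/-! Since each vector has norm at least `1`, some functional `f i` of norm at most `1` satisfies `f
i (x i) = 1`. The matrix `f i (x j)` has rank at most `d` and trace `m`, and Cauchy–Schwarz bounds
the squared trace by the rank times the sum of squared entries (`sq_card_le_finrank_mul_sum_sq`). So
if `M` bounds the square sum of every row, then `m ≤ d * M`.

Collapsing puts every sum of `k` entries of a row in `[-1, 1]`. Sorting the entries other than the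
diagonal `1` reduces the row to a few parameters, and convexity pushes the extremum to endpoints:
`sum_sq_le_of_two_mul_le` treats `m ≥ 2k`, `sum_sq_le_of_lt_two_mul` treats `m < 2k`. The bound `2d`
is attained by the vectors `±eᵢ` in the supremum norm. -/

/-! ### Square sums and sorted splittings -/

/-- After subtracting `t` the terms are nonnegative, so their square sum is at most the square of
their sum. The extremal case has all terms but one equal to `t`. -/
theorem sum_sq_le_of_forall_le {ι : Type*} (s : Finset ι) (f : ι → ℝ) (t : ℝ)
    (h : ∀ j ∈ s, t ≤ f j) :
    ∑ j ∈ s, f j ^ 2 ≤ (∑ j ∈ s, f j - ((#s : ℝ) - 1) * t) ^ 2 + ((#s : ℝ) - 1) * t ^ 2 := by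
  have h1 : ∑ j ∈ s, (f j - t) ^ 2 ≤ (∑ j ∈ s, (f j - t)) ^ 2 :=
    Finset.sum_sq_le_sq_sum_of_nonneg fun j hj => sub_nonneg.2 (h j hj)
  have h2 : ∑ j ∈ s, (f j - t) ^ 2
      = ∑ j ∈ s, f j ^ 2 - 2 * t * ∑ j ∈ s, f j + #s * t ^ 2 := by
    rw [Finset.mul_sum, ← nsmul_eq_mul, ← Finset.sum_const, ← Finset.sum_sub_distrib,
      ← Finset.sum_add_distrib]
    exact Finset.sum_congr rfl fun j _ => by ring
  have h3 : ∑ j ∈ s, (f j - t) = ∑ j ∈ s, f j - #s * t := by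
    rw [Finset.sum_sub_distrib, Finset.sum_const, nsmul_eq_mul]
  rw [h2, h3] at h1
  nlinarith [h1]

theorem exists_subset_card_eq_forall_ge {ι : Type*} [DecidableEq ι] (s : Finset ι) (f : ι → ℝ)
    {c : ℕ} (hc : c ≤ #s) :
    ∃ t ⊆ s, #t = c ∧ ∃ u, (∀ j ∈ t, u ≤ f j) ∧ ∀ j ∈ s \ t, f j ≤ u := by
  induction c with
  | zero =>
    obtain ⟨u, hu⟩ := (s.image f).bddAbove
    exact ⟨∅, by simp, rfl, u, by simp, fun j hj => hu (by
      simpa using ⟨j, by simpa using hj, rfl⟩)⟩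
  | succ c ih =>
    obtain ⟨t, hts, htc, u, h1, h2⟩ := ih (by omega)
    have hne : (s \ t).Nonempty := by
      rw [← Finset.card_pos, Finset.card_sdiff_of_subset hts]; omega
    obtain ⟨x, hx, hmax⟩ := Finset.exists_max_image (s \ t) f hne
    have hx' := Finset.mem_sdiff.1 hx
    refine ⟨insert x t, Finset.insert_subset hx'.1 hts, by
      rw [Finset.card_insert_of_notMem hx'.2, htc], f x, fun j hj => ?_, fun j hj => ?_⟩
    · rcases Finset.mem_insert.1 hj with rfl | hj
      · exact le_rfl
      · exact (h2 x hx).trans (h1 j hj)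
    · simp only [Finset.mem_sdiff, Finset.mem_insert, not_or] at hj
      exact hmax j (Finset.mem_sdiff.2 ⟨hj.1, hj.2.2⟩)

/-- A finite set splits into a top, a middle and a bottom part of prescribed sizes. -/
theorem exists_top_middle_bottom {ι : Type*} [DecidableEq ι] (s : Finset ι) (f : ι → ℝ)
    {p n q : ℕ} (hs : #s = p + n + q) :
    ∃ (P C Q : Finset ι) (u v : ℝ), Disjoint P C ∧ Disjoint P Q ∧ Disjoint C Q ∧
      P ∪ C ∪ Q = s ∧ #P = p ∧ #C = n ∧ #Q = q ∧ v ≤ u ∧ (∀ j ∈ P, u ≤ f j) ∧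
      (∀ j ∈ C, v ≤ f j ∧ f j ≤ u) ∧ (∀ j ∈ Q, f j ≤ v) := by
  obtain ⟨P, hP, hPc, u, hu1, hu2⟩ := exists_subset_card_eq_forall_ge s f (c := p) (by omega)
  have hsP : #(s \ P) = n + q := by rw [Finset.card_sdiff_of_subset hP]; omega
  obtain ⟨Q, hQ, hQc, v, hv1, hv2⟩ :=
    exists_subset_card_eq_forall_ge (s \ P) (fun j => - f j) (c := q) (by omega)
  have hdPQ : Disjoint P Q := Finset.disjoint_of_subset_right hQ Finset.disjoint_sdiff
  refine ⟨P, (s \ P) \ Q, Q, u, min u (-v),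
    Finset.disjoint_of_subset_right Finset.sdiff_subset Finset.disjoint_sdiff, hdPQ,
    Finset.sdiff_disjoint, ?_, hPc, ?_, hQc, min_le_left _ _, hu1, ?_, ?_⟩
  · rw [Finset.union_assoc, Finset.sdiff_union_of_subset hQ, Finset.union_sdiff_of_subset hP]
  · rw [Finset.card_sdiff_of_subset hQ]; omega
  · intro j hj
    have := hv2 j hj
    exact ⟨(min_le_right _ _).trans (by linarith), hu2 j (Finset.mem_sdiff.1 hj).1⟩
  · intro j hj
    have := hv1 j hj
    exact le_min (hu2 j (hQ hj)) (by linarith)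

/-! ### Rows with at least `2k` entries -/

/-- If a row has a unit entry at `i` and all sums of `k` entries lie in `[-1, 1]`, then the squares
of its entries are controlled when there are at least `2 * k` of them. -/
theorem sum_sq_le_of_two_mul_le {k m : ℕ} (hk : 3 ≤ k) (hm : 2 * k ≤ m) (b : Fin m → ℝ) (i : Fin m)
    (hi : b i = 1) (hb : ∀ I : Finset (Fin m), #I = k → |∑ j ∈ I, b j| ≤ 1) {M : ℝ}
    (hM : 2 ≤ M) (hM' : 2 + ((m : ℝ) - 4 * k + 2) / k ^ 2 ≤ M) :
    ∑ j, b j ^ 2 ≤ M := by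
  -- The sizes make both `{i} ∪ P` and `Q` sets of `k` indices. The first forces `u ≤ 0`, the second
  -- `k * v ≥ -1`.
  have hs : #(univ.erase i) = (k - 1) + (m - 2 * k) + k := by
    rw [Finset.card_erase_of_mem (mem_univ i), Finset.card_univ, Fintype.card_fin]; omega
  obtain ⟨P, C, Q, u, v, hPC, hPQ, hCQ, hU, hPc, hCc, hQc, hvu, hP, hC, hQ⟩ :=
    exists_top_middle_bottom _ b hs
  have hiP : i ∉ P := fun h => by
    have : i ∈ univ.erase i := hU ▸ by simp [h]
    simp at this
  have hkR : (3 : ℝ) ≤ k := by exact_mod_cast hk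
  have hPc' : (#P : ℝ) = k - 1 := by rw [hPc, Nat.cast_sub (by omega)]; simp
  have hCc' : (#C : ℝ) = m - 2 * k := by rw [hCc, Nat.cast_sub hm]; simp
  have hQc' : (#Q : ℝ) = k := by rw [hQc]
  have e1 := hb (insert i P) (by rw [Finset.card_insert_of_notMem hiP]; omega)
  rw [Finset.sum_insert hiP, hi, abs_le] at e1
  have e2 := hb Q hQc
  rw [abs_le] at e2
  have hPu : ((k : ℝ) - 1) * u ≤ ∑ j ∈ P, b j := by
    rw [← hPc', ← nsmul_eq_mul]; exact Finset.card_nsmul_le_sum _ _ _ hP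
  have hQv : ∑ j ∈ Q, b j ≤ k * v := by
    rw [← hQc', ← nsmul_eq_mul]; exact Finset.sum_le_card_nsmul _ _ _ hQ
  have hu0 : u ≤ 0 := by
    by_contra! h
    have := mul_pos (by linarith : (0 : ℝ) < k - 1) h
    linarith
  have hkv : -1 ≤ k * v := by linarith
  have sP := sum_sq_le_of_forall_le P b v fun j hj => hvu.trans (hP j hj)
  have sQ := sum_sq_le_of_forall_le Q (fun j => - b j) (-v) fun j hj => neg_le_neg (hQ j hj)
  have sC : ∑ j ∈ C, b j ^ 2 ≤ ((m : ℝ) - 2 * k) * v ^ 2 := by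
    rw [← hCc', ← nsmul_eq_mul]
    refine Finset.sum_le_card_nsmul _ _ _ fun j hj => ?_
    have := hC j hj
    rw [sq_le_sq, abs_of_nonpos (this.2.trans hu0), abs_of_nonpos (hvu.trans hu0)]
    linarith
  simp only [Finset.sum_neg_distrib, hQc', hPc', neg_sq] at sP sQ
  have hPv : ((k : ℝ) - 1) * v ≤ ∑ j ∈ P, b j :=
    (mul_le_mul_of_nonneg_left hvu (by linarith)).trans hPu
  have hT : ∑ j, b j ^ 2 = 1 + (∑ j ∈ P, b j ^ 2 + ∑ j ∈ C, b j ^ 2 + ∑ j ∈ Q, b j ^ 2) := by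
    rw [← Finset.add_sum_erase univ _ (mem_univ i), hi, ← hU, Finset.sum_union
      (Finset.disjoint_union_left.2 ⟨hPQ, hCQ⟩), Finset.sum_union hPC]
    norm_num
  rw [hT]
  generalize ∑ j ∈ P, b j = sp at *
  generalize ∑ j ∈ Q, b j = sq at *
  -- The quantity lies between `v` and `-(k - 2) * v`; `k ≥ 3` makes the second endpoint the larger
  -- in absolute value.
  have t1 : (sp - ((k : ℝ) - 1 - 1) * v) ^ 2 ≤ (((k : ℝ) - 2) * v) ^ 2 := by
    have h3 : 0 ≤ ((k : ℝ) - 3) * -v := mul_nonneg (by linarith) (by linarith)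
    rw [sq_le_sq, abs_le, abs_of_nonpos (by linarith : ((k : ℝ) - 2) * v ≤ 0)]
    constructor <;> linarith
  have t2 : (-sq - ((k : ℝ) - 1) * -v) ^ 2 ≤ (1 + ((k : ℝ) - 1) * v) ^ 2 := by
    apply pow_le_pow_left₀ <;> linarith
  obtain ⟨β, rfl⟩ : ∃ β, v = -β := ⟨-v, by simp⟩
  have hβ0 : 0 ≤ β := by linarith
  have hβk : k * β ≤ 1 := by linarith
  have key : ∑ j ∈ P, b j ^ 2 + ∑ j ∈ C, b j ^ 2 + ∑ j ∈ Q, b j ^ 2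
      ≤ 1 - 2 * ((k : ℝ) - 1) * β + (2 * ((k : ℝ) - 1) ^ 2 + m - 2 * k) * β ^ 2 := by
    linarith
  have hmk : (2 : ℝ) * k ≤ m := by exact_mod_cast hm
  have hc : (0 : ℝ) ≤ 2 * ((k : ℝ) - 1) ^ 2 + m - 2 * k := by
    linarith [sq_nonneg ((k : ℝ) - 1)]
  have hk0 : (0 : ℝ) < k := by linarith
  have hβ1 : β ≤ 1 / k := by rw [le_div_iff₀ hk0]; linarith
  -- Replacing `β ^ 2` by its chord `β / k` on `[0, 1 / k]` leaves a function affine in `k * β ∈ [0,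
  -- 1]`; its end values yield the two lower bounds required of `M`.
  have key2 : (2 * ((k : ℝ) - 1) ^ 2 + m - 2 * k) * β ^ 2
      ≤ (2 * ((k : ℝ) - 1) ^ 2 + m - 2 * k) * (β * (1 / k)) :=
    mul_le_mul_of_nonneg_left (by rw [pow_two]; exact mul_le_mul_of_nonneg_left hβ1 hβ0) hc
  have key3 : 1 - 2 * ((k : ℝ) - 1) * β + (2 * ((k : ℝ) - 1) ^ 2 + m - 2 * k) * (β * (1 / k))
      = 1 + (k * β) * (((m : ℝ) - 4 * k + 2) / k ^ 2) := by
    field_simp; ring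
  set w := ((m : ℝ) - 4 * k + 2) / k ^ 2
  have : (k * β) * w ≤ M - 2 := by
    have h0 : 0 ≤ k * β := by positivity
    rcases le_total 0 w with h | h
    · linarith [mul_le_mul_of_nonneg_right hβk h]
    · linarith [mul_nonpos_of_nonneg_of_nonpos h0 h]
  linarith

/-! ### Convexity and the trace–rank inequality -/

theorem quadratic_le_of_mem_Icc {a b c l r x M : ℝ} (ha : 0 ≤ a) (hl : l ≤ x) (hr : x ≤ r)
    (h1 : a * l ^ 2 + b * l + c ≤ M) (h2 : a * r ^ 2 + b * r + c ≤ M) :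
    a * x ^ 2 + b * x + c ≤ M := by
  rcases hl.eq_or_lt with rfl | hl'
  · exact h1
  · have h3 : 0 ≤ (r - x) * (M - (a * l ^ 2 + b * l + c)) :=
      mul_nonneg (by linarith) (by linarith)
    have h4 : 0 ≤ (x - l) * (M - (a * r ^ 2 + b * r + c)) :=
      mul_nonneg (by linarith) (by linarith)
    have h5 : 0 ≤ a * ((x - l) * (r - x) * (r - l)) :=
      mul_nonneg ha (mul_nonneg (mul_nonneg (by linarith) (by linarith)) (by linarith))
    have h6 : 0 ≤ (r - l) * (M - (a * x ^ 2 + b * x + c)) := by linarith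
    have := nonneg_of_mul_nonneg_right h6 (by linarith)
    linarith

/-- Expand the rows in an orthonormal basis `e` of a space `W` containing them, of dimension at most
that of `X`. The trace becomes a sum over pairs `(i, l)` of products of row coefficients and entries
of `e l`; Cauchy–Schwarz gives the square sum of the matrix times `dim W`. -/
theorem sq_card_le_finrank_mul_sum_sq {X : Type*} [NormedAddCommGroup X] [NormedSpace ℝ X]
    [FiniteDimensional ℝ X] {m : ℕ} (f : Fin m → (X →L[ℝ] ℝ)) (x : Fin m → X)
    (h : ∀ i, f i (x i) = 1) :
    (m : ℝ) ^ 2 ≤ Module.finrank ℝ X * ∑ i, ∑ j, f i (x j) ^ 2 := by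
  let φ : (X →L[ℝ] ℝ) →ₗ[ℝ] EuclideanSpace ℝ (Fin m) :=
    { toFun := fun g => WithLp.toLp 2 fun j => g (x j)
      map_add' := fun _ _ => rfl
      map_smul' := fun _ _ => rfl }
  let W := LinearMap.range φ
  have hW : Module.finrank ℝ W ≤ Module.finrank ℝ X := by
    refine (LinearMap.finrank_range_le φ).trans ?_
    rw [← (LinearMap.toContinuousLinearMap (𝕜 := ℝ) (E := X) (F' := ℝ)).finrank_eq]
    exact (Subspace.dual_finrank_eq (K := ℝ) (V := X)).le
  let e := stdOrthonormalBasis ℝ W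
  let r : Fin m → W := fun i => ⟨φ (f i), LinearMap.mem_range_self φ _⟩
  have hr : ∀ i j, (r i : EuclideanSpace ℝ (Fin m)) j = f i (x j) := fun _ _ => rfl
  have hdiag : ∀ i, ∑ l, inner ℝ (e l) (r i) * (e l : EuclideanSpace ℝ (Fin m)) i = 1 := by
    intro i
    have h1 := congrArg (fun w : W => (w : EuclideanSpace ℝ (Fin m)) i) (e.sum_repr' (r i))
    simp only [hr, h] at h1
    rw [← h1]
    simp
  have hnorm : ∀ i, ∑ l, inner ℝ (e l) (r i) ^ 2 = ∑ j, f i (x j) ^ 2 := by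
    intro i
    have h1 := e.sum_sq_inner_right (r i)
    rw [h1, Submodule.coe_norm, EuclideanSpace.real_norm_sq_eq]
    simp [hr]
  have hunit : ∀ l, ∑ i, (e l : EuclideanSpace ℝ (Fin m)) i ^ 2 = 1 := by
    intro l
    rw [← EuclideanSpace.real_norm_sq_eq, ← Submodule.coe_norm, e.norm_eq_one, one_pow]
  have hcs := Finset.sum_mul_sq_le_sq_mul_sq (univ : Finset (Fin m × Fin (Module.finrank ℝ W)))
    (fun p => inner ℝ (e p.2) (r p.1)) (fun p => (e p.2 : EuclideanSpace ℝ (Fin m)) p.1)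
  rw [Fintype.sum_prod_type, Fintype.sum_prod_type, Fintype.sum_prod_type_right] at hcs
  simp only [hdiag, hnorm, hunit] at hcs
  simp only [sum_const, card_univ, Fintype.card_fin, nsmul_eq_mul, mul_one] at hcs
  refine hcs.trans ?_
  rw [mul_comm]
  gcongr

/-! ### Rows with fewer than `2k` entries -/

/-- The extremal values of the sum of squares of a row with fewer than `2 * k` entries. -/
theorem corner_bound {K N T u v M : ℝ} (hK : 1 ≤ K) (hN : 1 ≤ N) (hT : 0 ≤ T)
    (hTN : T * (N + K + 1) ≤ N) (hM : 1 ≤ M)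
    (hM' : (1 - T) * (N * T + K) ≤ M * (K * (K + 1)))
    (hu1 : -T ≤ N * u) (hu2 : K * u ≤ T) (hv1 : T - 1 ≤ (K + 1) * v) (hv2 : N * v ≤ -T) :
    (T - (K - 1) * u) ^ 2 + (K - 1) * u ^ 2 + K * v ^ 2 + (1 - T + K * v) ^ 2
      - (u + v) * T - N * u * v ≤ M := by
  have hN0 : 0 < N := by linarith
  have hK0 : 0 < K := by linarith
  have lu : -T / N ≤ u := by rw [div_le_iff₀ hN0]; linarith
  have ru : u ≤ T / K := by rw [le_div_iff₀ hK0]; linarith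
  have lv : (T - 1) / (K + 1) ≤ v := by rw [div_le_iff₀ (by linarith)]; linarith
  have rv : v ≤ -T / N := by rw [le_div_iff₀ hN0]; linarith
  have rT : T ≤ N / (N + K + 1) := by rw [le_div_iff₀ (by linarith)]; linarith
  -- The expression is convex in `u` and in `v` separately, so the four corners suffice. At all but
  -- `(T / K, (T - 1) / (K + 1))` the value is convex in `T` and is checked at `T = 0` and `T = N /
  -- (N + K + 1)`.
  have corner : ∀ u', (u' = -T / N ∨ u' = T / K) →
      ∀ v', (v' = (T - 1) / (K + 1) ∨ v' = -T / N) →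
      (T - (K - 1) * u') ^ 2 + (K - 1) * u' ^ 2 + K * v' ^ 2 + (1 - T + K * v') ^ 2
      - (u' + v') * T - N * u' * v' ≤ M := by
    rintro u' (rfl | rfl) v' (rfl | rfl)
    · have := quadratic_le_of_mem_Icc (M := M)
        (a := (1 + (K - 1) / N) ^ 2 + (K - 1) / N ^ 2 + 1 / (K + 1) + 1 / N)
        (b := -2 / (K + 1)) (c := 1 / (K + 1)) (by
          have : 0 ≤ K - 1 := by linarith
          positivity) hT rT ?_ ?_
      · refine le_trans (le_of_eq ?_) this
        field_simp
        ring
      · have : 1 / (K + 1) ≤ 1 := by rw [div_le_one (by linarith)]; linarith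
        linarith
      · refine le_trans ?_ hM
        rw [← sub_nonneg]
        have : 1 - (((1 + (K - 1) / N) ^ 2 + (K - 1) / N ^ 2 + 1 / (K + 1) + 1 / N) *
            (N / (N + K + 1)) ^ 2 + -2 / (K + 1) * (N / (N + K + 1)) + 1 / (K + 1))
            = (3 * N + 2 * K) / (N + K + 1) ^ 2 := by
          field_simp
          ring
        rw [this]
        positivity
    · have := quadratic_le_of_mem_Icc (M := M)
        (a := (1 + (K - 1) / N) ^ 2 + (K - 1) / N ^ 2 + K / N ^ 2 + (1 + K / N) ^ 2 + 1 / N)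
        (b := -2 * (1 + K / N)) (c := 1) (by
          have : 0 ≤ K - 1 := by linarith
          positivity) hT rT ?_ ?_
      · refine le_trans (le_of_eq ?_) this
        field_simp
        ring
      · linarith
      · refine le_trans ?_ hM
        rw [← sub_nonneg]
        have : 1 - (((1 + (K - 1) / N) ^ 2 + (K - 1) / N ^ 2 + K / N ^ 2 + (1 + K / N) ^ 2
            + 1 / N) * (N / (N + K + 1)) ^ 2 + -2 * (1 + K / N) * (N / (N + K + 1)) + 1)
            = (3 * N + 2 * K) / (N + K + 1) ^ 2 := by
          field_simp
          ring
        rw [this]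
        positivity
    -- At this corner the value is concave in `T` and equals the left side of `h`, which is why
    -- `hM'` is assumed.
    · have h : (1 - T) * (N * T + K) / (K * (K + 1)) ≤ M := by
        rw [div_le_iff₀ (by positivity)]; exact hM'
      refine le_trans (le_of_eq ?_) h
      field_simp
      ring
    · have := quadratic_le_of_mem_Icc (M := M)
        (a := 1 / K + K / N ^ 2 + (1 + K / N) ^ 2 + 1 / N)
        (b := -2 * (1 + K / N)) (c := 1) (by positivity) hT rT ?_ ?_
      · refine le_trans (le_of_eq ?_) this
        field_simp
        ring
      · linarith
      · refine le_trans ?_ hM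
        rw [div_pow]
        have : (1 / K + K / N ^ 2 + (1 + K / N) ^ 2 + 1 / N) * (N ^ 2 / (N + K + 1) ^ 2)
            + -2 * (1 + K / N) * (N / (N + K + 1)) + 1
            = (N ^ 2 / K + N + K + 1) / (N + K + 1) ^ 2 := by
          field_simp
          ring
        rw [this, div_le_one (by positivity)]
        have : N ^ 2 / K ≤ N ^ 2 := div_le_self (by positivity) hK
        nlinarith
  have step : ∀ v', (v' = (T - 1) / (K + 1) ∨ v' = -T / N) →
      (T - (K - 1) * u) ^ 2 + (K - 1) * u ^ 2 + K * v' ^ 2 + (1 - T + K * v') ^ 2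
      - (u + v') * T - N * u * v' ≤ M := by
    intro v' hv'
    have := quadratic_le_of_mem_Icc (M := M) (a := (K - 1) ^ 2 + (K - 1))
      (b := -2 * T * (K - 1) - T - N * v')
      (c := T ^ 2 + K * v' ^ 2 + (1 - T + K * v') ^ 2 - v' * T) (by nlinarith) lu ru
      (by linarith [corner _ (Or.inl rfl) v' hv']) (by linarith [corner _ (Or.inr rfl) v' hv'])
    linarith
  have := quadratic_le_of_mem_Icc (M := M) (a := K + K ^ 2)
    (b := 2 * (1 - T) * K - T - N * u)
    (c := (T - (K - 1) * u) ^ 2 + (K - 1) * u ^ 2 + (1 - T) ^ 2 - u * T) (by positivity) lv rv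
    (by linarith [step _ (Or.inl rfl)]) (by linarith [step _ (Or.inr rfl)])
  linarith

/-- If a row of `N + 2 * K + 2` entries has a unit entry at `i` and all sums of `N + K + 1` entries
lie in `[-1, 1]`, then the squares of its entries are controlled. -/
theorem sum_sq_le_of_lt_two_mul {K N m : ℕ} (hK : 1 ≤ K) (hN : 1 ≤ N) (hm : m = N + 2 * K + 2)
    (b : Fin m → ℝ) (i : Fin m) (hi : b i = 1)
    (hb : ∀ I : Finset (Fin m), #I = N + K + 1 → |∑ j ∈ I, b j| ≤ 1) {M : ℝ} (hM : 1 ≤ M)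
    (hM' : ∀ T : ℝ, 0 ≤ T → (1 - T) * (N * T + K) ≤ M * (K * (K + 1))) :
    ∑ j, b j ^ 2 ≤ 1 + M := by
  -- With `k = N + K + 1`, both `{i} ∪ P ∪ C` and `C ∪ Q` have `k` elements. They overlap in `C`,
  -- whose sum `-T` becomes the main parameter.
  have hs : #(univ.erase i) = K + N + (K + 1) := by
    rw [Finset.card_erase_of_mem (mem_univ i), Finset.card_univ, Fintype.card_fin]; omega
  obtain ⟨P, C, Q, u, v, hPC, hPQ, hCQ, hU, hPc, hCc, hQc, hvu, hP, hC, hQ⟩ :=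
    exists_top_middle_bottom _ b hs
  have hiPC : i ∉ P ∪ C := fun h => by
    have : i ∈ univ.erase i := hU ▸ Finset.mem_union_left _ h
    simp at this
  have hKR : (1 : ℝ) ≤ K := by exact_mod_cast hK
  have hNR : (1 : ℝ) ≤ N := by exact_mod_cast hN
  have hQc' : (#Q : ℝ) = K + 1 := by rw [hQc]; push_cast; rfl
  have e1 := hb (insert i (P ∪ C)) (by
    rw [Finset.card_insert_of_notMem hiPC, Finset.card_union_of_disjoint hPC]; omega)
  rw [Finset.sum_insert hiPC, hi, Finset.sum_union hPC, abs_le] at e1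
  have e2 := hb (C ∪ Q) (by rw [Finset.card_union_of_disjoint hCQ]; omega)
  rw [Finset.sum_union hCQ, abs_le] at e2
  have hPu : (K : ℝ) * u ≤ ∑ j ∈ P, b j := by
    rw [← hPc, ← nsmul_eq_mul]; exact Finset.card_nsmul_le_sum _ _ _ hP
  have hQv : ∑ j ∈ Q, b j ≤ ((K : ℝ) + 1) * v := by
    rw [← hQc', ← nsmul_eq_mul]; exact Finset.sum_le_card_nsmul _ _ _ hQ
  have hCu : ∑ j ∈ C, b j ≤ N * u := by
    rw [← hCc, ← nsmul_eq_mul]; exact Finset.sum_le_card_nsmul _ _ _ fun j hj => (hC j hj).2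
  have hCv : N * v ≤ ∑ j ∈ C, b j := by
    rw [← hCc, ← nsmul_eq_mul]; exact Finset.card_nsmul_le_sum _ _ _ fun j hj => (hC j hj).1
  have sP := sum_sq_le_of_forall_le P b u hP
  have sQ := sum_sq_le_of_forall_le Q (fun j => - b j) (-v) fun j hj => neg_le_neg (hQ j hj)
  have sC : ∑ j ∈ C, b j ^ 2 ≤ (u + v) * ∑ j ∈ C, b j - N * u * v := by
    have h0 : ∑ j ∈ C, b j ^ 2 ≤ ∑ j ∈ C, ((u + v) * b j - u * v) :=
      Finset.sum_le_sum fun j hj => by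
        have := mul_nonneg (sub_nonneg.2 (hC j hj).1) (sub_nonneg.2 (hC j hj).2)
        linarith
    rw [Finset.sum_sub_distrib, ← Finset.mul_sum, Finset.sum_const, hCc, nsmul_eq_mul] at h0
    linarith
  simp only [Finset.sum_neg_distrib, hQc', hPc, neg_sq] at sP sQ
  have hT : ∑ j, b j ^ 2 = 1 + (∑ j ∈ P, b j ^ 2 + ∑ j ∈ C, b j ^ 2 + ∑ j ∈ Q, b j ^ 2) := by
    rw [← Finset.add_sum_erase univ _ (mem_univ i), hi, ← hU, Finset.sum_union
      (Finset.disjoint_union_left.2 ⟨hPQ, hCQ⟩), Finset.sum_union hPC]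
    norm_num
  rw [hT]
  generalize ∑ j ∈ P, b j = sp at *
  generalize ∑ j ∈ Q, b j = sq at *
  obtain ⟨T, hTC⟩ : ∃ T, ∑ j ∈ C, b j = -T := ⟨-∑ j ∈ C, b j, by simp⟩
  rw [hTC] at e1 e2 hCu hCv sC
  have hKu : K * u ≤ T := by linarith
  have hKv : T - 1 ≤ ((K : ℝ) + 1) * v := by linarith
  have hT0 : 0 ≤ T := by
    have h1 : N * (K * u) ≤ N * T := mul_le_mul_of_nonneg_left hKu (by linarith)
    have h2 : K * (-T) ≤ K * (N * u) := mul_le_mul_of_nonneg_left hCu (by linarith)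
    have h3 : 0 ≤ (N + K : ℝ) * T := by linarith
    exact nonneg_of_mul_nonneg_right h3 (by linarith)
  have hTN : T * (N + K + 1 : ℝ) ≤ N := by
    have h1 : N * (T - 1) ≤ N * (((K : ℝ) + 1) * v) := mul_le_mul_of_nonneg_left hKv (by linarith)
    have h2 : ((K : ℝ) + 1) * (N * v) ≤ ((K : ℝ) + 1) * (-T) :=
      mul_le_mul_of_nonneg_left hCv (by linarith)
    linarith
  have huT : -T ≤ u := by
    by_contra! h
    have : (N : ℝ) * u ≤ 1 * u := mul_le_mul_of_nonpos_right hNR (by linarith)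
    linarith
  have hv0 : v ≤ 0 := by
    by_contra! h
    have := mul_pos (by linarith : (0 : ℝ) < N) h
    linarith
  have t1 : (sp - ((K : ℝ) - 1) * u) ^ 2 ≤ (T - ((K : ℝ) - 1) * u) ^ 2 := by
    have h1 : -u ≤ T - ((K : ℝ) - 1) * u := by
      rcases le_total 0 u with h | h
      · linarith
      · rcases hK.eq_or_lt with rfl | hK2
        · norm_num; linarith
        · have : (2 : ℝ) ≤ K := by exact_mod_cast hK2
          have := mul_nonpos_of_nonneg_of_nonpos (by linarith : (0 : ℝ) ≤ K - 2) h
          linarith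
    rw [sq_le_sq, abs_le, abs_of_nonneg (by linarith : 0 ≤ T - ((K : ℝ) - 1) * u)]
    constructor <;> linarith
  have t2 : (-sq - ((K : ℝ) + 1 - 1) * -v) ^ 2 ≤ (1 - T + (K : ℝ) * v) ^ 2 := by
    apply pow_le_pow_left₀ <;> linarith
  have := corner_bound hKR hNR hT0 hTN hM (hM' T hT0) hCu hKu hKv hCv
  linarith

/-- The numerical inequality behind the bound for fewer than `2 * k` vectors. -/
theorem exists_bound_lt {K N m d : ℕ} (hK : 1 ≤ K) (hN : 1 ≤ N) (hm : m = N + 2 * K + 2)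
    (hd : 2 * d + 1 ≤ m) (hdK : d ≤ 2 * (K * (K + 1)) + 1) :
    ∃ M : ℝ, 1 ≤ M ∧ (∀ T : ℝ, 0 ≤ T → (1 - T) * (N * T + K) ≤ M * (K * (K + 1))) ∧
      d * (1 + M) < m := by
  have hKR : (1 : ℝ) ≤ K := by exact_mod_cast hK
  have hNR : (1 : ℝ) ≤ N := by exact_mod_cast hN
  have hmR : (m : ℝ) = N + 2 * K + 2 := by rw [hm]; push_cast; rfl
  have hdR : 2 * (d : ℝ) + 1 ≤ m := by exact_mod_cast hd
  rcases lt_or_ge N K with hNK | hNK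
  · have hNKR : (N : ℝ) ≤ K := by exact_mod_cast hNK.le
    refine ⟨1, le_rfl, fun T hT => ?_, by linarith⟩
    nlinarith [mul_nonneg (sub_nonneg.2 hNKR) hT, mul_nonneg (by linarith : (0 : ℝ) ≤ N)
      (sq_nonneg T)]
  have hNKR : (K : ℝ) ≤ N := by exact_mod_cast hNK
  have hR : (0 : ℝ) < K * (K + 1) := by positivity
  have hN0 : (0 : ℝ) < N := by linarith
  -- The second term comes from the maximum of `(1 - T) * (N * T + K)`, at `T = (N - K) / (2 * N)`.
  refine ⟨max 1 (((N + K : ℝ) ^ 2 / (4 * N)) / (K * (K + 1))), le_max_left _ _,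
    fun T hT => ?_, ?_⟩
  · have h1 : (1 - T) * (N * T + K) ≤ (N + K : ℝ) ^ 2 / (4 * N) := by
      rw [le_div_iff₀ (by positivity)]
      nlinarith [sq_nonneg (2 * N * T - (N - K : ℝ))]
    rw [← div_le_iff₀ hR]
    exact (div_le_div_of_nonneg_right h1 hR.le).trans (le_max_right _ _)
  · rw [← max_add_add_left, mul_max_of_nonneg _ _ (Nat.cast_nonneg d), max_lt_iff]
    refine ⟨by linarith, ?_⟩
    set X := (N + K : ℝ) ^ 2 / (4 * N) with hX
    have hX0 : 0 ≤ X := by positivity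
    have hXN : 4 * (N * X) = (N + K : ℝ) ^ 2 := by rw [hX]; field_simp
    suffices h : d * (K * (K + 1) + X) < m * (K * (K + 1) : ℝ) by
      rw [show (d : ℝ) * (1 + X / (K * (K + 1))) = d * (K * (K + 1) + X) / (K * (K + 1)) by
        field_simp, div_lt_iff₀ hR]
      exact h
    obtain ⟨R, hRdef⟩ : ∃ R : ℝ, R = K * (K + 1) := ⟨_, rfl⟩
    rw [← hRdef] at hR ⊢
    have hR2 : 2 ≤ R := by nlinarith
    -- Use the smaller of the bounds `(m - 1) / 2` and `2 * R + 1` for `d`; they cross at `m = 4 * R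
    -- + 3`.
    rcases le_or_gt (m : ℝ) (4 * R + 2) with hsmall | hbig
    · have h1 : d * (R + X) ≤ (m - 1) / 2 * (R + X) :=
        mul_le_mul_of_nonneg_right (by linarith) (by linarith)
      refine h1.trans_lt ?_
      suffices h : ((m : ℝ) - 1) * (4 * (N * X)) < 4 * N * ((m + 1) * R) by
        have : N * (((m : ℝ) - 1) * X) < N * ((m + 1) * R) := by linarith
        have := lt_of_mul_lt_mul_left this hN0.le
        linarith
      rw [hXN]
      have h2 : (N + K : ℝ) ^ 2 ≤ (4 * R) * N + K ^ 2 := by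
        have : N * (N + 2 * K : ℝ) ≤ N * (4 * R) := by
          gcongr; linarith
        linarith
      have h3 : ((m : ℝ) - 1) * (N + K : ℝ) ^ 2 ≤ (m - 1) * ((4 * R) * N + K ^ 2) := by
        apply mul_le_mul_of_nonneg_left h2; linarith
      refine h3.trans_lt ?_
      have h4 : ((m : ℝ) - 1) * K ^ 2 ≤ (4 * N) * K ^ 2 := by
        gcongr; linarith
      have h5 : (4 * N : ℝ) * K ^ 2 < 8 * N * R := by
        have : (K : ℝ) ^ 2 < R * 2 := by nlinarith
        nlinarith
      linarith
    · have hdK' : (d : ℝ) ≤ 2 * R + 1 := by rw [hRdef]; exact_mod_cast hdK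
      have h1 : d * (R + X) ≤ (2 * R + 1) * (R + X) :=
        mul_le_mul_of_nonneg_right hdK' (by linarith)
      refine h1.trans_lt ?_
      have hm3 : 4 * R + 3 ≤ m := by
        have h2 : 4 * (K * (K + 1)) + 2 < m := by rw [hRdef] at hbig; exact_mod_cast hbig
        rw [hRdef]
        exact_mod_cast h2
      have hN4 : 4 * R + 1 - 2 * K ≤ N := by linarith
      have hNK2 : 4 * (K : ℝ) ^ 2 ≤ N := by rw [hRdef] at hN4; linarith
      have h2 : (4 * R + 1 - 2 * K) * (2 * R - 1) ≤ N * (2 * R - 1) := by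
        apply mul_le_mul_of_nonneg_right hN4; linarith
      have h3 : 4 * (K : ℝ) ^ 2 * (2 * R - 1) ≤ N * (2 * R - 1) := by
        apply mul_le_mul_of_nonneg_right hNK2; linarith
      have h4 : N * (2 * R - 1) ≤ N * (N * (2 * R - 1) + 4 * K * R - 2 * K + 4 * R - 8 * R ^ 2) := by
        apply mul_le_mul_of_nonneg_left _ hN0.le; linarith
      have h5 : (2 * R + 1) * (K : ℝ) ^ 2 < 4 * (K : ℝ) ^ 2 * (2 * R - 1) := by
        have : 0 < (K : ℝ) ^ 2 * (6 * R - 5) := mul_pos (by positivity) (by linarith)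
        linarith
      have h6 : 4 * N * ((2 * R + 1) * (R + X)) < 4 * N * (m * R) := by
        rw [hmR, show 4 * N * ((2 * R + 1) * (R + X))
          = (2 * R + 1) * (4 * N * R + 4 * (N * X)) by ring, hXN]
        linarith
      exact lt_of_mul_lt_mul_left h6 (by linarith)

/-! ### From collapsing families to matrices -/

theorem IsCollapsing.comp_injective {X : Type*} [NormedAddCommGroup X] {k m n : ℕ}
    {x : Fin m → X} (hx : IsCollapsing k x) (e : Fin n ↪ Fin m) : IsCollapsing k (x ∘ e) := by
  intro I hI
  have := hx (I.map e) (by rw [Finset.card_map, hI])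
  rwa [Finset.sum_map] at this

/-- A collapsing family of vectors of norm at least one has a Gram-type matrix with unit diagonal
and with collapsing rows, whose rank is at most the dimension of the space. -/
theorem IsCollapsing.exists_matrix {X : Type*} [NormedAddCommGroup X] [NormedSpace ℝ X]
    [FiniteDimensional ℝ X] {k m : ℕ} {x : Fin m → X} (hx : IsCollapsing k x)
    (h1 : ∀ i, 1 ≤ ‖x i‖) :
    ∃ a : Fin m → Fin m → ℝ, (∀ i, a i i = 1) ∧
      (∀ i (I : Finset (Fin m)), #I = k → |∑ j ∈ I, a i j| ≤ 1) ∧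
      (m : ℝ) ^ 2 ≤ Module.finrank ℝ X * ∑ i, ∑ j, a i j ^ 2 := by
  have hf : ∀ i, ∃ f : X →L[ℝ] ℝ, ‖f‖ ≤ 1 ∧ f (x i) = 1 := by
    intro i
    have hpos : 0 < ‖x i‖ := one_pos.trans_le (h1 i)
    obtain ⟨g, hg, hgx⟩ := exists_dual_vector ℝ (x i) hpos.ne'
    refine ⟨‖x i‖⁻¹ • g, ?_, ?_⟩
    · rw [norm_smul, hg, mul_one, norm_inv, norm_norm]
      exact inv_le_one_of_one_le₀ (h1 i)
    · simp [hgx, hpos.ne']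
  choose f hf1 hfx using hf
  refine ⟨fun i j => f i (x j), hfx, fun i I hI => ?_, sq_card_le_finrank_mul_sum_sq f x hfx⟩
  rw [← map_sum, ← Real.norm_eq_abs]
  exact ((f i).le_opNorm _).trans (mul_le_one₀ (hf1 i) (norm_nonneg _) (hx I hI))

theorem IsCollapsing.le_finrank_mul {X : Type*} [NormedAddCommGroup X] [NormedSpace ℝ X]
    [FiniteDimensional ℝ X] {k m : ℕ} {x : Fin m → X} (hx : IsCollapsing k x)
    (h1 : ∀ i, 1 ≤ ‖x i‖) (hm : 0 < m) {M : ℝ}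
    (hM : ∀ (b : Fin m → ℝ) (i : Fin m), b i = 1 →
      (∀ I : Finset (Fin m), #I = k → |∑ j ∈ I, b j| ≤ 1) → ∑ j, b j ^ 2 ≤ M) :
    (m : ℝ) ≤ Module.finrank ℝ X * M := by
  obtain ⟨a, ha1, ha2, ha3⟩ := hx.exists_matrix h1
  have h2 : ∑ i, ∑ j, a i j ^ 2 ≤ m * M := by
    refine (Finset.sum_le_card_nsmul univ _ M fun i _ => hM (a i) i (ha1 i) (ha2 i)).trans_eq ?_
    simp
  have h3 := ha3.trans (mul_le_mul_of_nonneg_left h2 (Nat.cast_nonneg _))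
  have hm' : (0 : ℝ) < m := by exact_mod_cast hm
  exact le_of_mul_le_mul_left (by linarith) hm'

theorem IsCollapsing.card_le_of_two_mul_le {X : Type*} [NormedAddCommGroup X] [NormedSpace ℝ X]
    [FiniteDimensional ℝ X] {k m : ℕ} {x : Fin m → X} (hx : IsCollapsing k x)
    (h1 : ∀ i, 1 ≤ ‖x i‖) (hk : 3 ≤ k) (hm : 2 * k ≤ m) :
    m ≤ 2 * Module.finrank ℝ X ∨
      (m : ℝ) * k ^ 2 ≤ Module.finrank ℝ X * (2 * k ^ 2 + (m - 4 * k + 2)) := by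
  have h := hx.le_finrank_mul h1 (by omega) (M := max 2 (2 + ((m : ℝ) - 4 * k + 2) / k ^ 2))
    fun b i hi hb => sum_sq_le_of_two_mul_le hk hm b i hi hb (le_max_left _ _) (le_max_right _ _)
  rw [mul_max_of_nonneg _ _ (Nat.cast_nonneg _), le_max_iff] at h
  refine h.imp (fun h => ?_) fun h => ?_
  · rw [mul_comm]; exact_mod_cast h
  · have hk0 : (0 : ℝ) < k := by positivity
    have := mul_le_mul_of_nonneg_right h (by positivity : (0 : ℝ) ≤ k ^ 2)
    refine this.trans_eq ?_
    field_simp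

theorem IsCollapsing.card_le_of_lt_two_mul {X : Type*} [NormedAddCommGroup X] [NormedSpace ℝ X]
    [FiniteDimensional ℝ X] {k m K : ℕ} {x : Fin m → X} (hx : IsCollapsing k x)
    (h1 : ∀ i, 1 ≤ ‖x i‖) (hm : m = k + K + 1) (hmk : m < 2 * k) (hK : 1 ≤ K)
    (hdK : Module.finrank ℝ X ≤ 2 * (K * (K + 1)) + 1) : m ≤ 2 * Module.finrank ℝ X := by
  by_contra! hd
  obtain ⟨N, rfl⟩ : ∃ N, k = N + K + 1 := ⟨k - K - 1, by omega⟩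
  obtain ⟨M, hM1, hM2, hM3⟩ := exists_bound_lt (m := m) hK (by omega : 1 ≤ N) (by omega) hd hdK
  exact hM3.not_ge (hx.le_finrank_mul h1 (by omega) fun b i hi hb =>
    sum_sq_le_of_lt_two_mul hK (by omega) (by omega) b i hi hb hM1 hM2)

/-! ### Finiteness and the lower bound -/

theorem maxCollapsingNumber_le {k d B : ℕ}
    (h : ∀ (X : Type) [NormedAddCommGroup X] [NormedSpace ℝ X] [FiniteDimensional ℝ X],
      Module.finrank ℝ X = d → ∀ (m : ℕ) (x : Fin m → X), (∀ i, 1 ≤ ‖x i‖) →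
      IsCollapsing k x → m ≤ B) : maxCollapsingNumber k d ≤ B := by
  refine sSup_le ?_
  rintro _ ⟨X, _, _, hX, hd, rfl⟩
  refine sSup_le ?_
  rintro _ ⟨m, x, h1, hx, rfl⟩
  exact_mod_cast h X hd m x h1 hx

theorem exists_maxCollapsingNumber_eq {k d : ℕ} {B : ℝ} (hB : 0 ≤ B)
    (h : ∀ (X : Type) [NormedAddCommGroup X] [NormedSpace ℝ X] [FiniteDimensional ℝ X],
      Module.finrank ℝ X = d → ∀ (m : ℕ) (x : Fin m → X), (∀ i, 1 ≤ ‖x i‖) →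
      IsCollapsing k x → (m : ℝ) ≤ B) :
    ∃ C : ℕ, maxCollapsingNumber k d = (C : ℕ∞) ∧ (C : ℝ) ≤ B := by
  have h1 : maxCollapsingNumber k d ≤ (⌊B⌋₊ : ℕ) :=
    maxCollapsingNumber_le fun X _ _ _ hX m x hx1 hx => Nat.le_floor (h X hX m x hx1 hx)
  obtain ⟨C, hC⟩ := ENat.ne_top_iff_exists.1 (ne_top_of_le_ne_top (ENat.natCast_ne_top _) h1)
  rw [← hC] at h1
  exact ⟨C, hC.symm, (Nat.cast_le.2 (by exact_mod_cast h1)).trans (Nat.floor_le hB)⟩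

/-- The vectors `±eᵢ` of `ℝ^d` with the supremum norm are collapsing. -/
theorem two_mul_le_maxCollapsingNumber (k d : ℕ) : ((2 * d : ℕ) : ℕ∞) ≤ maxCollapsingNumber k d := by
  refine le_trans ?_ (le_sSup ⟨Fin d → ℝ, inferInstance, inferInstance, inferInstance, by simp,
    rfl⟩)
  refine le_sSup ⟨2 * d, fun i j => (if (i : ℕ) = j then 1 else 0)
    - (if (i : ℕ) = j + d then 1 else 0), fun i => ?_, fun I _ => ?_, rfl⟩
  · rcases lt_or_ge (i : ℕ) d with hi | hi
    · refine le_trans ?_ (norm_le_pi_norm _ ⟨i, hi⟩)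
      have : d ≠ 0 := by omega
      simp [this]
    · refine le_trans ?_ (norm_le_pi_norm _ ⟨i - d, by omega⟩)
      have h1 : (i : ℕ) ≠ i - d := by omega
      have h2 : (i : ℕ) = i - d + d := by omega
      simp [h1, ← h2]
  · rw [pi_norm_le_iff_of_nonneg zero_le_one]
    intro j
    -- At most one index equals `c`, so each coordinate of the sum is a difference of two numbers in
    -- `[0, 1]`.
    have key : ∀ c : ℕ, (0 : ℝ) ≤ ∑ i ∈ I, (if (i : ℕ) = c then 1 else 0) ∧
        ∑ i ∈ I, (if (i : ℕ) = c then (1 : ℝ) else 0) ≤ 1 := by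
      intro c
      refine ⟨Finset.sum_nonneg fun i _ => by split_ifs <;> norm_num, ?_⟩
      rw [Finset.sum_boole]
      have : #(I.filter fun i : Fin (2 * d) => (i : ℕ) = c) ≤ 1 := Finset.card_le_one.2 fun a ha b hb => by
        simp only [Finset.mem_filter] at ha hb
        exact Fin.ext (ha.2.trans hb.2.symm)
      exact_mod_cast this
    rw [Finset.sum_apply, Finset.sum_sub_distrib, Real.norm_eq_abs, abs_le]
    have h1 := key j
    have h2 := key (j + d)
    constructor <;> linarith

/-! ### The three ranges of `k` -/

theorem theorem1p13 (k d : ℕ) (hk : 3 ≤ k) (hd : 2 ≤ d) :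
    (√(d : ℝ) < (k : ℝ) → (k : ℝ) ≤ ((d : ℝ) + 1) / 2 →
      (∃ C : ℕ, maxCollapsingNumber k d = (C : ℕ∞) ∧
        (C : ℝ) ≤ 2 * (d : ℝ) * ((k : ℝ) - 1) ^ 2 / ((k : ℝ) ^ 2 - (d : ℝ))) ∧
      2 * (d : ℝ) * ((k : ℝ) - 1) ^ 2 / ((k : ℝ) ^ 2 - (d : ℝ)) =
        2 * (d : ℝ) * (1 + ((d : ℝ) - 2 * (k : ℝ) + 1) / ((k : ℝ) ^ 2 - (d : ℝ)))) ∧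
    (-2 * (d : ℝ) + √(6 * (d : ℝ) ^ 2 + 3 * (d : ℝ) + 1) ≤ (k : ℝ) →
      (k : ℝ) ≤ 2 * (d : ℝ) - √((d : ℝ) / 2) →
      maxCollapsingNumber k d = ((2 * d : ℕ) : ℕ∞)) ∧
    (3 ≤ d → 2 * (d : ℝ) - √((d : ℝ) / 2) < (k : ℝ) →
      ∃ C : ℕ, maxCollapsingNumber k d = (C : ℕ∞) ∧
        (C : ℝ) ≤ (k : ℝ) + (1 + √(2 * (d : ℝ) - 3)) / 2) := by
  have hdR : (2 : ℝ) ≤ d := by exact_mod_cast hd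
  have hkR : (3 : ℝ) ≤ k := by exact_mod_cast hk
  refine ⟨fun h1 h2 => ?_, fun h1 h2 => ?_, fun hd3 h1 => ?_⟩
  · have hlt : (d : ℝ) < k ^ 2 := (Real.sqrt_lt' (by linarith)).1 h1
    have hpos : (0 : ℝ) < k ^ 2 - d := by linarith
    have heq : 2 * (d : ℝ) * ((k : ℝ) - 1) ^ 2 / ((k : ℝ) ^ 2 - (d : ℝ)) =
        2 * (d : ℝ) * (1 + ((d : ℝ) - 2 * (k : ℝ) + 1) / ((k : ℝ) ^ 2 - (d : ℝ))) := by
      field_simp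
      ring
    refine ⟨exists_maxCollapsingNumber_eq (by positivity) fun X _ _ _ hX m x hx1 hx => ?_, heq⟩
    have hsmall : m ≤ 2 * d → (m : ℝ) ≤ 2 * d * (k - 1) ^ 2 / (k ^ 2 - d) := by
      intro hm
      have hmR : (m : ℝ) ≤ 2 * d * 1 := by rw [mul_one]; exact_mod_cast hm
      rw [heq]
      refine hmR.trans (mul_le_mul_of_nonneg_left ?_ (by positivity))
      have : 0 ≤ ((d : ℝ) - 2 * k + 1) / (k ^ 2 - d) := div_nonneg (by linarith) hpos.le
      linarith
    rcases lt_or_ge m (2 * k) with hm | hm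
    · refine hsmall ?_
      have : 2 * k ≤ d + 1 := by
        have : 2 * (k : ℝ) ≤ d + 1 := by linarith
        exact_mod_cast this
      omega
    · rcases hx.card_le_of_two_mul_le hx1 hk hm with h | h <;> rw [hX] at h
      · exact hsmall h
      · rw [le_div_iff₀ hpos]
        linarith
  · refine le_antisymm (maxCollapsingNumber_le fun X _ _ _ hX m x hx1 hx => ?_)
      (two_mul_le_maxCollapsingNumber k d)
    by_contra! hm
    -- Passing to exactly `2d + 1` vectors makes the bounds depend on `k` and `d` alone.
    have hy := hx.comp_injective (Fin.castLEEmb hm)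
    have hy1 : ∀ i, 1 ≤ ‖(x ∘ Fin.castLEEmb hm) i‖ := fun i => hx1 _
    rcases lt_or_ge (2 * d + 1) (2 * k) with hmk | hmk
    · have hkd : (k : ℝ) ≤ 2 * d := h2.trans (sub_le_self _ (Real.sqrt_nonneg _))
      have hkd' : k ≤ 2 * d := by exact_mod_cast hkd
      obtain ⟨K, hK⟩ : ∃ K, 2 * d = k + K := Nat.exists_eq_add_of_le hkd'
      have hKR : 2 * (d : ℝ) = k + K := by exact_mod_cast hK
      have h3 : (d : ℝ) / 2 ≤ K ^ 2 := (Real.sqrt_le_left (Nat.cast_nonneg _)).1 (by linarith)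
      have h4 : d ≤ 2 * K ^ 2 := by
        have : (d : ℝ) ≤ 2 * K ^ 2 := by linarith
        exact_mod_cast this
      have hK1 : 1 ≤ K := by
        rcases Nat.eq_zero_or_pos K with rfl | h
        · omega
        · exact h
      have := hy.card_le_of_lt_two_mul (K := K) hy1 (by omega) hmk hK1 (by rw [hX]; nlinarith)
      omega
    · rcases hy.card_le_of_two_mul_le hy1 hk hmk with h | h <;> rw [hX] at h
      · omega
      -- With `2d + 1` vectors, `h` rearranges to `(k + 2 * d) ^ 2 ≤ 6 * d ^ 2 + 3 * d`.
      · have h3 : 6 * (d : ℝ) ^ 2 + 3 * d + 1 ≤ (k + 2 * d) ^ 2 :=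
          (Real.sqrt_le_left (by positivity)).1 (by linarith)
        push_cast at h
        linarith
  · refine exists_maxCollapsingNumber_eq (by positivity) fun X _ _ _ hX m x hx1 hx => ?_
    by_contra! hm
    have hd3R : (3 : ℝ) ≤ d := by exact_mod_cast hd3
    obtain ⟨s, hs⟩ : ∃ s, s = √((d : ℝ) / 2) := ⟨_, rfl⟩
    obtain ⟨t, ht⟩ : ∃ t, t = √(2 * (d : ℝ) - 3) := ⟨_, rfl⟩
    have hs0 : 0 ≤ s := hs ▸ Real.sqrt_nonneg _
    have ht0 : 0 ≤ t := ht ▸ Real.sqrt_nonneg _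
    have hs2 : 2 * s ^ 2 = d := by rw [hs, Real.sq_sqrt (by positivity)]; ring
    have ht2 : t ^ 2 = 2 * d - 3 := by rw [ht, Real.sq_sqrt (by linarith)]
    rw [← hs] at h1
    rw [← ht] at hm
    -- The opposite inequality would give `t ≤ 1`, hence `d ≤ 2`. This is what puts the assumed `m`
    -- above `2d`.
    have hst : 2 * s < 1 + t := by
      by_contra! h
      have h2 : (1 + t) ^ 2 ≤ (2 * s) ^ 2 := pow_le_pow_left₀ (by linarith) h 2
      have h3 : t ^ 2 ≤ 1 := pow_le_one₀ ht0 (by linarith)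
      linarith
    have hmd : 2 * d < m := by
      have : 2 * (d : ℝ) < m := by linarith
      exact_mod_cast this
    rcases lt_or_ge m (2 * k) with hmk | hmk
    · obtain ⟨K, hK⟩ : ∃ K, m = k + 1 + K := by
        refine Nat.exists_eq_add_of_le ?_
        have : (k : ℝ) < m := by linarith
        exact_mod_cast this
      have hKR : (m : ℝ) = k + 1 + K := by exact_mod_cast hK
      have h3 : t < 2 * K + 1 := by linarith
      have h4 : d ≤ 2 * (K * (K + 1)) + 1 := by
        have h5 : t ^ 2 < (2 * K + 1) ^ 2 := pow_lt_pow_left₀ h3 ht0 two_ne_zero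
        rw [ht2] at h5
        have : (d : ℝ) < 2 * (K * (K + 1)) + 2 := by linarith
        have h6 : d < 2 * (K * (K + 1)) + 2 := by exact_mod_cast this
        omega
      have hK1 : 1 ≤ K := by
        rcases Nat.eq_zero_or_pos K with rfl | h
        · omega
        · exact h
      have := hx.card_le_of_lt_two_mul (K := K) hx1 (by omega) hmk hK1 (by rw [hX]; exact h4)
      omega
    · rcases hx.card_le_of_two_mul_le hx1 hk hmk with h | h <;> rw [hX] at h
      · omega
      · have hkd : (d : ℝ) ≤ k := by nlinarith
        have hmR : 2 * (d : ℝ) < m := by exact_mod_cast hmd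
        have h3 : (d : ℝ) < k ^ 2 := by nlinarith
        have h4 : 2 * (d : ℝ) * (k ^ 2 - d) < m * (k ^ 2 - d) :=
          mul_lt_mul_of_pos_right hmR (by linarith)
        have h5 : 0 ≤ (d : ℝ) * (2 * k - 1 - d) := mul_nonneg (by linarith) (by linarith)
        linarith
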